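/- Let $F$ be a real homogeneous polynomial of degree $d\ge 1$ on $\mathbb{R}^n$ and let $\Gamma\subset\mathbb{R}^n$ be a lattice of full rank, i.e. $\Gamma=\{\sum_{j=1}^n \ell_j v_j:\ \ell_j\in\mathbb{Z}\}$ for some linearly independent vectors $v_1,\dots,v_n\in\mathbb{R}^n$. Let $\Gamma^*=\{\xi\in\mathbb{R}^n:\ \xi\cdot y\in\mathbb{Z}\ \text{for all } y\in\Gamma\}$ be the dual lattice and let $\mathrm{Vol}(\Gamma^*)$ be the Lebesgue measure of a fundamental domain of $\Gamma^*$. For $R>0$ put $F_R=F\chi_R$, where $\chi_R$ is the characteristic function of the closed Euclidean ball of radius $R$ centred at the origin, and let $\mathbb{B}^n_1$ be the unit ball of $\mathbb{R}^n$ centred at the origin. Then the weighted lattice point counting function $$\mathscr{M}(R)=\sum_{\lambda\in\Gamma}F_R(\lambda)=\sum_{\lambda\in\Gamma,\ |\lambda|\le R}F(\lambda)$$ satisfies $$\mathscr{M}(R)=\Bigl(\mathrm{Vol}(\Gamma^*)\int_{\mathbb{B}^n_1}F(x)\,dx\Bigr)R^{d+n}+O\bigl(R^{d+n-\frac{2}{n+1}}\bigr)\qquad\text{as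 } R\to\infty .$$ Moreover, for every fixed $h\in\mathbb{R}^n$, the shifted counting function $\mathscr{M}^h(R)=\sum_{\lambda\in\Gamma}F_R(\lambda+h)$ satisfies $$\mathscr{M}^h(R)=\Bigl(\mathrm{Vol}(\Gamma^*)\int_{\mathbb{B}^n_1}F(x)\,dx\Bigr)R^{d+n}+O\bigl(R^{d+n-\frac{2}{n+1}}\bigr)\qquad\text{as } R\to\infty .$$ -/

import Mathlib

open Filter Asymptotics MeasureTheory

noncomputable section

/-- The dual lattice `Γ* = {ξ : ⟪ξ, y⟫ ∈ ℤ for all y ∈ Γ}` of a subgroup `Γ` of `ℝⁿ`, with respect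
to the standard inner product. -/
def dualLattice {n : ℕ} (Γ : Submodule ℤ (EuclideanSpace ℝ (Fin n))) :
    Submodule ℤ (EuclideanSpace ℝ (Fin n)) :=
  LinearMap.BilinForm.dualSubmodule (innerₗ (EuclideanSpace ℝ (Fin n))) Γ

theorem mem_dualLattice {n : ℕ} (Γ : Submodule ℤ (EuclideanSpace ℝ (Fin n)))
    (ξ : EuclideanSpace ℝ (Fin n)) :
    ξ ∈ dualLattice Γ ↔ ∀ y ∈ Γ, ∃ k : ℤ, inner ℝ ξ y = (k : ℝ) := by
  simp [dualLattice, LinearMap.BilinForm.mem_dualSubmodule, Submodule.mem_one, eq_comm]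

/-- The polynomial function on `ℝⁿ` given by a polynomial in `n` variables. -/
def polyFun {n : ℕ} (F : MvPolynomial (Fin n) ℝ) (x : EuclideanSpace ℝ (Fin n)) : ℝ :=
  MvPolynomial.eval (fun i => x i) F

/-- `F_R = F · χ_R`, where `χ_R` is the characteristic function of the closed ball of radius `R`
centred at the origin. -/
def truncatedPoly {n : ℕ} (F : MvPolynomial (Fin n) ℝ) (R : ℝ) :
    EuclideanSpace ℝ (Fin n) → ℝ :=
  (Metric.closedBall (0 : EuclideanSpace ℝ (Fin n)) R).indicator (polyFun F)

/-- The weighted counting function `M(R) = ∑_{λ ∈ Γ} F_R(λ)`; only finitely many terms are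
nonzero when `Γ` is a lattice. -/
def weightedCount {n : ℕ} (F : MvPolynomial (Fin n) ℝ)
    (Γ : Submodule ℤ (EuclideanSpace ℝ (Fin n))) (R : ℝ) : ℝ :=
  ∑' v : Γ, truncatedPoly F R (v : EuclideanSpace ℝ (Fin n))

/-- The shifted weighted counting function `M^h(R) = ∑_{λ ∈ Γ} F_R(λ + h)`. -/
def shiftedWeightedCount {n : ℕ} (F : MvPolynomial (Fin n) ℝ)
    (Γ : Submodule ℤ (EuclideanSpace ℝ (Fin n))) (h : EuclideanSpace ℝ (Fin n)) (R : ℝ) : ℝ :=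
  ∑' v : Γ, truncatedPoly F R ((v : EuclideanSpace ℝ (Fin n)) + h)

/-- The sums defining the (shifted) counting functions are finite sums. -/
theorem finite_support_truncatedPoly {n : ℕ} (F : MvPolynomial (Fin n) ℝ)
    (Γ : Submodule ℤ (EuclideanSpace ℝ (Fin n))) [DiscreteTopology Γ]
    (h : EuclideanSpace ℝ (Fin n)) (R : ℝ) :
    (Function.support
      fun v : Γ => truncatedPoly F R ((v : EuclideanSpace ℝ (Fin n)) + h)).Finite := by
  have hfin : (Metric.closedBall (-h) R ∩ (Γ : Set (EuclideanSpace ℝ (Fin n)))).Finite := by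
    have : DiscreteTopology Γ.toAddSubgroup := inferInstanceAs (DiscreteTopology Γ)
    have hcl : IsClosed (Γ : Set (EuclideanSpace ℝ (Fin n))) :=
      AddSubgroup.isClosed_of_discrete (H := Γ.toAddSubgroup)
    exact Metric.finite_isBounded_inter_isClosed (isDiscrete_iff_discreteTopology.mpr ‹_›)
      Metric.isBounded_closedBall hcl
  refine (hfin.preimage (f := fun v : Γ => (v : EuclideanSpace ℝ (Fin n)))
    Subtype.val_injective.injOn).subset ?_
  intro v hv
  have hv' := Set.mem_of_indicator_ne_zero hv
  refine ⟨?_, v.2⟩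
  simpa [Metric.mem_closedBall, dist_eq_norm] using hv'

end

/-! For `n ≥ 1` one has `2 / (n + 1) ≤ 1`, so the stated error is implied by the elementary bound
`O(R ^ (d + n - 1))`, and no Fourier analysis or Poisson summation is needed. Replace each lattice
value of `truncatedPoly F R`, multiplied by the covolume, by an integral over a translate of a
bounded fundamental domain (`abs_covolume_mul_tsum_sub_integral_le`). Inside the ball the
replacement costs the oscillation of `F`, of order `R ^ (d - 1)` on volume of order `R ^ n`; near
the sphere it costs the size of `F`, of order `R ^ d` on a shell of volume of order `R ^ (n - 1)`.
Homogeneity evaluates the main integral, and `covolume_dualLattice` turns the inverse covolume of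
`Γ` into `Vol(Γ*)`. A shift by `h` merely translates the integrals. -/

open Module in
/-- The covolume of the dual lattice is the inverse of the covolume. -/
theorem covolume_dualLattice {n : ℕ} (Γ : Submodule ℤ (EuclideanSpace ℝ (Fin n)))
    [DiscreteTopology Γ] [IsZLattice ℝ Γ] :
    ZLattice.covolume (dualLattice Γ) = (ZLattice.covolume Γ)⁻¹ := by
  classical
  set B : LinearMap.BilinForm ℝ (EuclideanSpace ℝ (Fin n)) :=
    innerₗ (EuclideanSpace ℝ (Fin n)) with hBdef
  have hB : B.Nondegenerate := by
    refine ⟨fun x hx => ?_, fun x hx => ?_⟩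
    · exact inner_self_eq_zero (𝕜 := ℝ).1 (hx x)
    · exact inner_self_eq_zero (𝕜 := ℝ).1 (hx x)
  let e : Basis (Fin n) ℝ (EuclideanSpace ℝ (Fin n)) :=
    (EuclideanSpace.basisFun (Fin n) ℝ).toBasis
  have he : MeasureTheory.volume.real (ZSpan.fundamentalDomain e) = 1 := by
    rw [measureReal_congr (ZSpan.fundamentalDomain_ae_parallelepiped e volume), measureReal_def]
    have := (EuclideanSpace.basisFun (Fin n) ℝ).volume_parallelepiped
    simp only [e, OrthonormalBasis.coe_toBasis, this, ENNReal.toReal_one]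
  have hrank : finrank ℝ (EuclideanSpace ℝ (Fin n)) = Fintype.card (Fin n) := by simp
  let ι := Free.ChooseBasisIndex ℤ Γ
  have hcard : Fintype.card ι = Fintype.card (Fin n) := by
    rw [← hrank, ← ZLattice.rank ℝ Γ, finrank_eq_card_chooseBasisIndex]
  let b₀ : Basis (Fin n) ℤ Γ := (Free.chooseBasis ℤ Γ).reindex (Fintype.equivOfCardEq hcard)
  let b : Basis (Fin n) ℝ (EuclideanSpace ℝ (Fin n)) := b₀.ofZLatticeBasis ℝ Γ
  let c : Basis (Fin n) ℝ (EuclideanSpace ℝ (Fin n)) := B.dualBasis hB b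
  have hdual : dualLattice Γ = Submodule.span ℤ (Set.range c) := by
    rw [← LinearMap.BilinForm.dualSubmodule_span_of_basis B hB b,
      b₀.ofZLatticeBasis_span ℝ, dualLattice]
  have hΓ : ZLattice.covolume Γ = |e.det b| := by
    rw [ZLattice.covolume_eq_det_mul_measureReal Γ volume b₀ e, he, mul_one]
    congr 2
    ext1 i
    exact (b₀.ofZLatticeBasis_apply ℝ Γ i).symm
  have hdualcov : ZLattice.covolume (dualLattice Γ) = |e.det c| := by
    rw [hdual, ZLattice.covolume_eq_measure_fundamentalDomain _ volume
      (ZSpan.isAddFundamentalDomain c volume), ZSpan.measureReal_fundamentalDomain _ _ e, he,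
      mul_one]
  -- Since `e` is orthonormal, the entries are the inner products of `c i` with `b j`, which duality
  -- makes Kronecker deltas.
  have hprod : (e.toMatrix c).transpose * e.toMatrix b = 1 := by
    ext i j
    have h1 := LinearMap.BilinForm.apply_dualBasis_left (B := B) hB b i j
    rw [Matrix.one_apply, Matrix.mul_apply]
    simp only [@eq_comm _ i j]
    rw [← h1]
    simp only [Matrix.transpose_apply, Basis.toMatrix_apply, e, hBdef, innerₗ_apply_apply, c,
      PiLp.inner_apply, OrthonormalBasis.coe_toBasis_repr_apply, EuclideanSpace.basisFun_repr]
    exact Finset.sum_congr rfl fun k _ => mul_comm _ _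
  have hdet : e.det c * e.det b = 1 := by
    rw [Basis.det_apply, Basis.det_apply, ← Matrix.det_transpose (e.toMatrix c),
      ← Matrix.det_mul, hprod, Matrix.det_one]
  rw [hΓ, hdualcov]
  refine eq_inv_of_mul_eq_one_left ?_
  rw [← abs_mul, hdet, abs_one]

/-! ### Lattice sums against integrals -/

open scoped Pointwise in
/-- Comparison of a lattice sum with an integral: if on every translate of a fundamental domain
`D` the function `g` differs from its value at the lattice point by at most `G`, then the sum of
`g` over the shifted lattice, multiplied by the covolume, differs from `∫ g` by at most `∫ G`. -/
theorem abs_covolume_mul_tsum_sub_integral_le {E : Type*} [NormedAddCommGroup E] [NormedSpace ℝ E]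
    [FiniteDimensional ℝ E] [MeasurableSpace E] [BorelSpace E] (μ : Measure E)
    [μ.IsAddHaarMeasure] (L : Submodule ℤ E) [DiscreteTopology L] [IsZLattice ℝ L]
    {D : Set E} (hD : IsAddFundamentalDomain L D μ) (hDfin : μ D ≠ ⊤)
    (g G : E → ℝ) (hg : Integrable g μ) (hG : Integrable G μ) (h : E)
    (hsum : Summable fun v : L => g (v + h))
    (hle : ∀ v : L, ∀ x ∈ D, |g (v + h) - g (v + x + h)| ≤ G (v + x + h)) :
    |ZLattice.covolume L μ * ∑' v : L, g (v + h) - ∫ x, g x ∂μ| ≤ ∫ x, G x ∂μ := by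
  have hint (f : E → ℝ) (hf : Integrable f μ) (v : L) :
      IntegrableOn (fun x => f (v + x + h)) D μ := by
    have := (hf.comp_add_right h).comp_add_left (v : E)
    exact this.integrableOn
  -- The translates of `D` tile the space up to null sets; each piece is pulled back to `D`, and the
  -- shift by `h` leaves the total integral unchanged.
  have key (f : E → ℝ) (hf : Integrable f μ) :
      HasSum (fun v : L => ∫ x in D, f (v + x + h) ∂μ) (∫ x, f x ∂μ) := by
    have hf' : Integrable (fun x => f (x + h)) μ := hf.comp_add_right h
    have : MeasurableVAdd L E := (inferInstance : MeasurableVAdd L.toAddSubgroup E)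
    have : VAddInvariantMeasure L E μ :=
      (inferInstance : VAddInvariantMeasure L.toAddSubgroup E μ)
    have hsr := hD.sum_restrict
    have h1 : HasSum (fun v : L => ∫ x in v +ᵥ D, f (x + h) ∂μ) (∫ x, f (x + h) ∂μ) := by
      have := hasSum_integral_measure (f := fun x => f (x + h))
        (μ := fun v : L => μ.restrict (v +ᵥ D)) (by rwa [hsr])
      rwa [hsr] at this
    rw [integral_add_right_eq_self f h] at h1
    convert h1 using 2 with v
    exact ((measurePreserving_add_left μ (v : E)).setIntegral_image_emb
      (measurableEmbedding_addLeft (v : E)) (fun x => f (x + h)) D).symm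
  have h2 : HasSum (fun v : L => ∫ _x in D, g (v + h) ∂μ)
      (ZLattice.covolume L μ * ∑' v : L, g (v + h)) := by
    simp only [setIntegral_const, smul_eq_mul,
      ← ZLattice.covolume_eq_measure_fundamentalDomain L μ hD]
    exact hsum.hasSum.mul_left _
  have h3 := h2.sub (key g hg)
  have h4 := key G hG
  have hD' : NullMeasurableSet D μ := hD.nullMeasurableSet
  have hbound (v : L) : |(∫ _x in D, g (v + h) ∂μ) - ∫ x in D, g (v + x + h) ∂μ| ≤
      ∫ x in D, G (v + x + h) ∂μ := by
    have hconst : IntegrableOn (fun _ : E => g (v + h)) D μ := integrableOn_const hDfin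
    rw [← integral_sub hconst (hint g hg v)]
    refine (abs_integral_le_integral_abs).trans ?_
    refine integral_mono_ae (hconst.sub (hint g hg v)).abs (hint G hG v) ?_
    exact (ae_restrict_iff'₀ hD').2 (Eventually.of_forall fun x hx => hle v x hx)
  rw [abs_le]
  refine ⟨?_, hasSum_le (fun v => (abs_le.1 (hbound v)).2) h3 h4⟩
  exact hasSum_le (fun v => (abs_le.1 (hbound v)).1) h4.neg h3

/-! ### Homogeneous polynomials on balls -/

theorem contDiff_polyFun {n : ℕ} (F : MvPolynomial (Fin n) ℝ) (k : WithTop ℕ∞) :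
    ContDiff ℝ k (polyFun F) := by
  unfold polyFun
  induction F using MvPolynomial.induction_on with
  | C a => simpa using contDiff_const
  | add p q hp hq => simpa using hp.add hq
  | mul_X p i hp =>
    have : ContDiff ℝ k fun x : EuclideanSpace ℝ (Fin n) => x i := by fun_prop
    simpa using hp.mul this

theorem polyFun_smul {n d : ℕ} {F : MvPolynomial (Fin n) ℝ} (hF : F.IsHomogeneous d) (r : ℝ)
    (x : EuclideanSpace ℝ (Fin n)) : polyFun F (r • x) = r ^ d * polyFun F x := by
  simp only [polyFun, MvPolynomial.eval_eq', Finset.mul_sum, PiLp.smul_apply, smul_eq_mul, mul_pow,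
    Finset.prod_mul_distrib, Finset.prod_pow_eq_pow_sum]
  refine Finset.sum_congr rfl fun m hm => ?_
  have hdeg := hF (MvPolynomial.mem_support_iff.1 hm)
  rw [Finsupp.weight_apply, Finsupp.sum_fintype _ _ (by simp)] at hdeg
  simp only [Pi.one_apply, smul_eq_mul, mul_one] at hdeg
  rw [hdeg]
  ring

/-- Compactness of the unit ball gives a bound and a Lipschitz constant there; rescaling by `R`
makes one `K` serve all radii. The Lipschitz estimate loses one power of `R` because distances
shrink by `R⁻¹`. -/
theorem exists_polyFun_bounds {n d : ℕ} {F : MvPolynomial (Fin n) ℝ} (hF : F.IsHomogeneous d)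
    (hd : 1 ≤ d) :
    ∃ K : ℝ, 0 ≤ K ∧ ∀ R : ℝ, 0 < R → ∀ x y : EuclideanSpace ℝ (Fin n), ‖x‖ ≤ R → ‖y‖ ≤ R →
      |polyFun F x| ≤ K * R ^ d ∧ |polyFun F x - polyFun F y| ≤ K * R ^ (d - 1) * ‖x - y‖ := by
  obtain ⟨K, hK⟩ := ((contDiff_polyFun F 1).contDiffOn
    (s := Metric.closedBall 0 1)).exists_lipschitzOnWith (by simp)
    (convex_closedBall _ _) (isCompact_closedBall _ _)
  obtain ⟨M, hM⟩ := (isCompact_closedBall (0 : EuclideanSpace ℝ (Fin n)) 1).exists_bound_of_continuousOn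
    (contDiff_polyFun F 1).continuous.continuousOn
  refine ⟨max (K : ℝ) M, le_max_of_le_left K.2, fun R hR x y hx hy => ?_⟩
  have hmem (z : EuclideanSpace ℝ (Fin n)) (hz : ‖z‖ ≤ R) :
      R⁻¹ • z ∈ Metric.closedBall (0 : EuclideanSpace ℝ (Fin n)) 1 := by
    rw [mem_closedBall_zero_iff, norm_smul, norm_inv, Real.norm_of_nonneg hR.le]
    exact inv_mul_le_one_of_le₀ hz hR.le
  have hscale (z : EuclideanSpace ℝ (Fin n)) : polyFun F z = R ^ d * polyFun F (R⁻¹ • z) := by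
    rw [← polyFun_smul hF, smul_inv_smul₀ hR.ne']
  have hRd : 0 < R ^ d := pow_pos hR d
  constructor
  · rw [hscale x, abs_mul, abs_of_pos hRd, mul_comm]
    gcongr
    exact (hM _ (hmem x hx)).trans (le_max_right _ _)
  · rw [hscale x, hscale y, ← mul_sub, abs_mul, abs_of_pos hRd]
    have h1 := hK.dist_le_mul _ (hmem x hx) _ (hmem y hy)
    rw [Real.dist_eq, dist_eq_norm, ← smul_sub, norm_smul, norm_inv,
      Real.norm_of_nonneg hR.le] at h1
    obtain ⟨k, rfl⟩ : ∃ k, d = k + 1 := ⟨d - 1, by omega⟩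
    calc R ^ (k + 1) * |polyFun F (R⁻¹ • x) - polyFun F (R⁻¹ • y)|
        ≤ R ^ (k + 1) * (K * (R⁻¹ * ‖x - y‖)) := by gcongr
      _ = K * R ^ k * ‖x - y‖ := by rw [pow_succ]; field_simp
      _ ≤ max (K : ℝ) M * R ^ k * ‖x - y‖ := by gcongr; exact le_max_left _ _

theorem integral_truncatedPoly {n d : ℕ} {F : MvPolynomial (Fin n) ℝ} (hF : F.IsHomogeneous d)
    {R : ℝ} (hR : 0 < R) :
    ∫ x, truncatedPoly F R x =
      (∫ x in Metric.closedBall (0 : EuclideanSpace ℝ (Fin n)) 1, polyFun F x) * R ^ (d + n) := by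
  have h := Measure.setIntegral_comp_smul_of_pos volume (polyFun F)
    (Metric.closedBall (0 : EuclideanSpace ℝ (Fin n)) 1) hR
  simp only [polyFun_smul hF, integral_const_mul, finrank_euclideanSpace_fin, smul_eq_mul] at h
  rw [smul_unitClosedBall_of_nonneg hR.le] at h
  unfold truncatedPoly
  rw [integral_indicator Metric.isClosed_closedBall.measurableSet]
  have := pow_pos hR n
  field_simp at h
  rw [← h]
  ring

/-- A homogeneous polynomial truncated to a ball, at two points at distance at most `C`. -/
theorem abs_truncatedPoly_sub_le {n d : ℕ} {F : MvPolynomial (Fin n) ℝ} {K C R : ℝ} (hK : 0 ≤ K)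
    (hC : 0 ≤ C) (hR : 0 < R)
    (hb : ∀ x y : EuclideanSpace ℝ (Fin n), ‖x‖ ≤ R → ‖y‖ ≤ R →
      |polyFun F x| ≤ K * R ^ d ∧ |polyFun F x - polyFun F y| ≤ K * R ^ (d - 1) * ‖x - y‖)
    {x y : EuclideanSpace ℝ (Fin n)} (hxy : ‖x - y‖ ≤ C) :
    |truncatedPoly F R x - truncatedPoly F R y| ≤
      (Metric.closedBall (0 : EuclideanSpace ℝ (Fin n)) R).indicator
          (fun _ => K * C * R ^ (d - 1)) y +
        (Metric.closedBall (0 : EuclideanSpace ℝ (Fin n)) (R + C) \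
          Metric.ball 0 (R - C)).indicator (fun _ => K * R ^ d) y := by
  have h1 : 0 ≤ (Metric.closedBall (0 : EuclideanSpace ℝ (Fin n)) R).indicator
          (fun _ => K * C * R ^ (d - 1)) y :=
    Set.indicator_nonneg (fun _ _ => by positivity) _
  have h2 : 0 ≤ (Metric.closedBall (0 : EuclideanSpace ℝ (Fin n)) (R + C) \
          Metric.ball 0 (R - C)).indicator (fun _ => K * R ^ d) y :=
    Set.indicator_nonneg (fun _ _ => by positivity) _
  have hyx : ‖y‖ ≤ ‖x‖ + C := by
    have := norm_sub_norm_le y x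
    rw [norm_sub_rev] at this
    linarith
  have hxy' : ‖x‖ ≤ ‖y‖ + C := by linarith [norm_sub_norm_le x y]
  unfold truncatedPoly
  -- If both points lie in the ball, the Lipschitz bound applies. If exactly one does, `y` is within
  -- `C` of the sphere in norm, hence in the shell, and the size bound applies.
  by_cases hx : ‖x‖ ≤ R <;> by_cases hy : ‖y‖ ≤ R
  · rw [Set.indicator_of_mem (by simpa using hx), Set.indicator_of_mem (by simpa using hy)]
    refine le_add_of_le_of_nonneg ?_ h2
    rw [Set.indicator_of_mem (by simpa using hy)]
    calc _ ≤ K * R ^ (d - 1) * ‖x - y‖ := (hb x y hx hy).2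
      _ ≤ K * R ^ (d - 1) * C := by gcongr
      _ = _ := by ring
  · rw [Set.indicator_of_mem (by simpa using hx),
      Set.indicator_of_notMem (s := Metric.closedBall 0 R) (a := y) (by simpa using hy), sub_zero]
    refine le_add_of_nonneg_of_le h1 ?_
    rw [Set.indicator_of_mem]
    · exact (hb x x hx hx).1
    · simp only [Set.mem_sdiff, mem_closedBall_zero_iff, mem_ball_zero_iff, not_lt]
      constructor <;> linarith
  · rw [Set.indicator_of_notMem (s := Metric.closedBall 0 R) (a := x) (by simpa using hx),
      Set.indicator_of_mem (by simpa using hy), zero_sub, abs_neg]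
    refine le_add_of_nonneg_of_le h1 ?_
    rw [Set.indicator_of_mem]
    · exact (hb y y hy hy).1
    · simp only [Set.mem_sdiff, mem_closedBall_zero_iff, mem_ball_zero_iff, not_lt]
      constructor <;> linarith
  · rw [Set.indicator_of_notMem (s := Metric.closedBall 0 R) (a := x) (by simpa using hx),
      Set.indicator_of_notMem (s := Metric.closedBall 0 R) (a := y) (by simpa using hy), sub_zero,
      abs_zero]
    exact add_nonneg h1 h2

/-! ### Volume of the boundary shell -/

theorem volume_real_closedBall_zero {n : ℕ} {r : ℝ} (hr : 0 ≤ r) :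
    volume.real (Metric.closedBall (0 : EuclideanSpace ℝ (Fin n)) r) =
      r ^ n * volume.real (Metric.ball (0 : EuclideanSpace ℝ (Fin n)) 1) := by
  rw [Measure.addHaar_real_closedBall _ _ hr, finrank_euclideanSpace_fin]

theorem volume_real_annulus_le {n : ℕ} {R C : ℝ} (hC : 0 ≤ C) (hR : C < R) :
    volume.real (Metric.closedBall (0 : EuclideanSpace ℝ (Fin n)) (R + C) \
        Metric.ball 0 (R - C)) ≤
      (2 * C * n * 2 ^ (n - 1) * R ^ (n - 1)) *
        volume.real (Metric.ball (0 : EuclideanSpace ℝ (Fin n)) 1) := by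
  rw [measureReal_sdiff (Metric.ball_subset_closedBall.trans
      (Metric.closedBall_subset_closedBall (by linarith))) Metric.isOpen_ball.measurableSet
      measure_closedBall_lt_top.ne,
    volume_real_closedBall_zero (by linarith),
    measureReal_def _ (Metric.ball 0 (R - C)), Measure.addHaar_ball_of_pos _ _ (by linarith),
    finrank_euclideanSpace_fin, ENNReal.toReal_mul,
    ENNReal.toReal_ofReal (pow_nonneg (by linarith) n), ← measureReal_def, ← sub_mul]
  refine mul_le_mul_of_nonneg_right ?_ measureReal_nonneg
  have h := (le_abs_self _).trans (abs_pow_sub_pow_le (R + C) (R - C) n)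
  have h2 : max |R + C| |R - C| ≤ 2 * R := by
    refine max_le ?_ ?_ <;> rw [abs_le] <;> constructor <;> linarith
  have h3 : |R + C - (R - C)| = 2 * C := by
    rw [show R + C - (R - C) = 2 * C by ring, abs_of_nonneg (by linarith)]
  rw [h3] at h
  calc _ ≤ _ := h
    _ ≤ 2 * C * n * (2 * R) ^ (n - 1) := by gcongr
    _ = _ := by rw [mul_pow]; ring

/-! ### The asymptotic formula -/

theorem exists_abs_shiftedWeightedCount_sub_le {n d : ℕ} (hd : 1 ≤ d) (hn : 1 ≤ n)
    {F : MvPolynomial (Fin n) ℝ} (hF : F.IsHomogeneous d)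
    (Γ : Submodule ℤ (EuclideanSpace ℝ (Fin n))) [DiscreteTopology Γ] [IsZLattice ℝ Γ]
    (h : EuclideanSpace ℝ (Fin n)) :
    ∃ A R₀ : ℝ, ∀ R : ℝ, R₀ ≤ R →
      |shiftedWeightedCount F Γ h R - (ZLattice.covolume (dualLattice Γ) *
        ∫ x in Metric.closedBall (0 : EuclideanSpace ℝ (Fin n)) 1, polyFun F x) * R ^ (d + n)| ≤
        A * R ^ (d + n - 1) := by
  obtain ⟨K, hK, hb⟩ := exists_polyFun_bounds hF hd (n := n)
  let b := Module.Free.chooseBasis ℤ Γ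
  have hD := ZLattice.isAddFundamentalDomain b (volume : Measure (EuclideanSpace ℝ (Fin n)))
  set D := ZSpan.fundamentalDomain (b.ofZLatticeBasis ℝ Γ)
  have hDb : Bornology.IsBounded D := ZSpan.fundamentalDomain_isBounded _
  obtain ⟨C, hCpos, hC⟩ := hDb.exists_pos_norm_le
  have hcov := ZLattice.covolume_pos Γ (volume : Measure (EuclideanSpace ℝ (Fin n)))
  set V := volume.real (Metric.ball (0 : EuclideanSpace ℝ (Fin n)) 1)
  -- The two summands come from the ball and the shell. The threshold `C + 1` keeps the inner radius
  -- `R - C` positive.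
  refine ⟨(ZLattice.covolume Γ)⁻¹ * (K * C * V + K * (2 * C * n * 2 ^ (n - 1) * V)), C + 1,
    fun R hR => ?_⟩
  have hR0 : 0 < R := by linarith
  set S := Metric.closedBall (0 : EuclideanSpace ℝ (Fin n)) R
  set T := Metric.closedBall (0 : EuclideanSpace ℝ (Fin n)) (R + C) \ Metric.ball 0 (R - C)
  have hS : MeasurableSet S := Metric.isClosed_closedBall.measurableSet
  have hT : MeasurableSet T :=
    Metric.isClosed_closedBall.measurableSet.diff Metric.isOpen_ball.measurableSet
  have hSfin : volume S ≠ ⊤ := measure_closedBall_lt_top.ne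
  have hTfin : volume T ≠ ⊤ :=
    ((measure_mono Set.sdiff_subset).trans_lt measure_closedBall_lt_top).ne
  have hSi : Integrable (S.indicator fun _ => K * C * R ^ (d - 1)) volume :=
    (integrable_indicator_iff hS).2 (integrableOn_const hSfin)
  have hTi : Integrable (T.indicator fun _ => K * R ^ d) volume :=
    (integrable_indicator_iff hT).2 (integrableOn_const hTfin)
  have hgi : Integrable (truncatedPoly F R) volume :=
    (integrable_indicator_iff hS).2
      ((contDiff_polyFun F 1).continuous.continuousOn.integrableOn_compact
        (isCompact_closedBall _ _))
  have hmain := abs_covolume_mul_tsum_sub_integral_le volume Γ hD hDb.measure_lt_top.ne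
    (truncatedPoly F R) _ hgi (hSi.add hTi) h
    (summable_of_hasFiniteSupport (finite_support_truncatedPoly F Γ h R))
    (fun v x hx => abs_truncatedPoly_sub_le hK hCpos.le hR0 (hb R hR0) (by
      rw [show (v : EuclideanSpace ℝ (Fin n)) + h - (v + x + h) = -x by abel, norm_neg]
      exact hC x hx))
  rw [integral_truncatedPoly hF hR0] at hmain
  simp only [Pi.add_apply] at hmain
  rw [integral_add hSi hTi, integral_indicator_const _ hS, integral_indicator_const _ hT,
    smul_eq_mul, smul_eq_mul, volume_real_closedBall_zero hR0.le] at hmain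
  have hann := volume_real_annulus_le (n := n) hCpos.le (by linarith : C < R)
  have hfinal : |ZLattice.covolume Γ * shiftedWeightedCount F Γ h R -
      (∫ x in Metric.closedBall (0 : EuclideanSpace ℝ (Fin n)) 1, polyFun F x) * R ^ (d + n)| ≤
      (K * C * V + K * (2 * C * n * 2 ^ (n - 1) * V)) * R ^ (d + n - 1) := by
    refine hmain.trans ?_
    have e1 : R ^ n * R ^ (d - 1) = R ^ (d + n - 1) := by rw [← pow_add]; congr 1; omega
    have e2 : R ^ (n - 1) * R ^ d = R ^ (d + n - 1) := by rw [← pow_add]; congr 1; omega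
    calc _ ≤ R ^ n * V * (K * C * R ^ (d - 1)) +
          2 * C * n * 2 ^ (n - 1) * R ^ (n - 1) * V * (K * R ^ d) := by gcongr
      _ = K * C * V * (R ^ n * R ^ (d - 1)) +
          K * (2 * C * n * 2 ^ (n - 1) * V) * (R ^ (n - 1) * R ^ d) := by ring
      _ = _ := by rw [e1, e2]; ring
  have hscale : shiftedWeightedCount F Γ h R - (ZLattice.covolume (dualLattice Γ) *
      ∫ x in Metric.closedBall (0 : EuclideanSpace ℝ (Fin n)) 1, polyFun F x) * R ^ (d + n) =
      (ZLattice.covolume Γ)⁻¹ * (ZLattice.covolume Γ * shiftedWeightedCount F Γ h R -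
      (∫ x in Metric.closedBall (0 : EuclideanSpace ℝ (Fin n)) 1, polyFun F x) * R ^ (d + n)) := by
    rw [covolume_dualLattice, mul_sub, inv_mul_cancel_left₀ hcov.ne', mul_assoc]
  rw [hscale, abs_mul, abs_of_pos (inv_pos.2 hcov), mul_assoc]
  gcongr

theorem shiftedWeightedCount_sub_isBigO {n d : ℕ} (hd : 1 ≤ d) {F : MvPolynomial (Fin n) ℝ}
    (hF : F.IsHomogeneous d) (Γ : Submodule ℤ (EuclideanSpace ℝ (Fin n)))
    [DiscreteTopology Γ] [IsZLattice ℝ Γ] (h : EuclideanSpace ℝ (Fin n)) :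
    (fun R : ℝ => shiftedWeightedCount F Γ h R -
        (ZLattice.covolume (dualLattice Γ) *
          ∫ x in Metric.closedBall (0 : EuclideanSpace ℝ (Fin n)) 1, polyFun F x) * R ^ (d + n))
      =O[atTop] fun R : ℝ => R ^ ((d : ℝ) + (n : ℝ) - 2 / ((n : ℝ) + 1)) := by
  -- For `n = 0` the saving `2 / (n + 1) = 2` exceeds 1, but there `F` vanishes identically because
  -- `d ≥ 1`.
  rcases Nat.eq_zero_or_pos n with rfl | hn
  · have hzero (x : EuclideanSpace ℝ (Fin 0)) : polyFun F x = 0 := by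
      have := polyFun_smul hF 0 x
      rwa [zero_pow (by omega), zero_mul, Subsingleton.elim ((0 : ℝ) • x) x] at this
    have hzero' (R : ℝ) (x : EuclideanSpace ℝ (Fin 0)) : truncatedPoly F R x = 0 := by
      simp [truncatedPoly, hzero]
    simpa [shiftedWeightedCount, hzero, hzero'] using isBigO_zero _ _
  obtain ⟨A, R₀, hA⟩ := exists_abs_shiftedWeightedCount_sub_le hd hn hF Γ h
  refine IsBigO.of_bound |A| ?_
  filter_upwards [eventually_ge_atTop R₀, eventually_ge_atTop 1] with R hR hR1
  rw [Real.norm_eq_abs, Real.norm_of_nonneg (by positivity)]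
  refine (hA R hR).trans ?_
  refine (mul_le_mul_of_nonneg_right (le_abs_self A) (by positivity)).trans ?_
  refine mul_le_mul_of_nonneg_left ?_ (abs_nonneg A)
  rw [← Real.rpow_natCast]
  refine Real.rpow_le_rpow_of_exponent_le hR1 ?_
  have hn' : (1 : ℝ) ≤ n := by exact_mod_cast hn
  -- This is where the elementary exponent `d + n - 1` is seen to suffice.
  have h2 : 2 / ((n : ℝ) + 1) ≤ 1 := by
    rw [div_le_one (by linarith)]
    linarith
  rw [Nat.cast_sub (by omega), Nat.cast_add, Nat.cast_one]
  linarith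

theorem mainTheorem1 (n d : ℕ) (hd : 1 ≤ d) (F : MvPolynomial (Fin n) ℝ)
    (hF : F.IsHomogeneous d) (Γ : Submodule ℤ (EuclideanSpace ℝ (Fin n)))
    [DiscreteTopology Γ] [IsZLattice ℝ Γ] :
    ((fun R : ℝ => weightedCount F Γ R -
        (ZLattice.covolume (dualLattice Γ) *
          ∫ x in Metric.closedBall (0 : EuclideanSpace ℝ (Fin n)) 1, polyFun F x) * R ^ (d + n))
      =O[atTop] fun R : ℝ => R ^ ((d : ℝ) + (n : ℝ) - 2 / ((n : ℝ) + 1))) ∧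
    ∀ h : EuclideanSpace ℝ (Fin n),
      (fun R : ℝ => shiftedWeightedCount F Γ h R -
        (ZLattice.covolume (dualLattice Γ) *
          ∫ x in Metric.closedBall (0 : EuclideanSpace ℝ (Fin n)) 1, polyFun F x) * R ^ (d + n))
      =O[atTop] fun R : ℝ => R ^ ((d : ℝ) + (n : ℝ) - 2 / ((n : ℝ) + 1)) := by
  refine ⟨?_, shiftedWeightedCount_sub_isBigO hd hF Γ⟩
  simpa [shiftedWeightedCount, weightedCount] using shiftedWeightedCount_sub_isBigO hd hF Γ 0
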